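/- Let $M$ be a compact connected smooth surface with smooth (possibly empty) boundary $\partial M$, equipped with a smooth Riemannian metric $g=(g_{ij})$ whose Gaussian curvature $K$ vanishes nowhere on $M$. Assume that the geodesic curvature $k_g$ of $\partial M$ vanishes at only finitely many points of $\partial M$. Let $\psi\colon M\to\mathbb{R}$ be a function of class $C^2$ (up to the boundary) that satisfies on $M$ the Monge--Ampère equation $$\det[D^2\psi]=\frac{\det(g_{ij})\,K}{2}\,|\nabla\psi|^2,$$ where, in local coordinates, $D^2\psi$ is the matrix $\partial_i\partial_j\psi-\sum_k\Gamma^k_{ij}\partial_k\psi$ of the Hessian of $\psi$ with respect to the Levi-Civita connection $\nabla$ of $g$, and $|\nabla\psi|^2=g(\nabla\psi,\nabla\psi)$. Suppose that the vector field $X=J\nabla\psi$, where $J$ is the rotation by a right angle (defined by a local choice of orientation; the conditions do not depend on this choice), satisfies the boundary conditions $$g(X,n)=g(\nabla_XX,n)=0\quad\text{on }\partial M,$$ where $n$ is the unit normal to $\partial M$. Then $\psi$ is constant. -/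

import Mathlib

open scoped Manifold ContDiff Matrix

noncomputable section

namespace SurfaceGeometry

/-- The coordinate plane in which the charts of a surface with boundary take their values. -/
abbrev Plane : Type := EuclideanSpace ℝ (Fin 2)

/-! ### Riemannian calculus in one coordinate patch

The charts of a surface with boundary take values in the closed half plane `y 0 ≥ 0`, which is
`Set.range (𝓡∂ 2)`. In this part `G` is a matrix-valued function on the plane, the matrix
`(g_{ij})` of a metric in coordinates, and a vector field is given by its components. -/

/-- The partial derivative `∂ᵢ f`. It is taken within the closed half plane, so it is the ordinary
one off the line `y 0 = 0` and the one-sided one, up to the boundary, on this line. -/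
def partialDeriv (i : Fin 2) (f : Plane → ℝ) (y : Plane) : ℝ :=
  fderivWithin ℝ f (Set.range (𝓡∂ 2)) y (EuclideanSpace.single i 1)

/-- The Christoffel symbol
`Γᵏᵢⱼ = ½ ∑ₗ gᵏˡ (∂ᵢ g_{jl} + ∂ⱼ g_{il} - ∂ₗ g_{ij})` of the Levi-Civita connection. -/
def christoffel (G : Plane → Matrix (Fin 2) (Fin 2) ℝ) (k i j : Fin 2) (y : Plane) : ℝ :=
  (1 / 2) * ∑ l, (G y)⁻¹ k l *
    (partialDeriv i (fun z => G z j l) y + partialDeriv j (fun z => G z i l) y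
      - partialDeriv l (fun z => G z i j) y)

/-- The component `Rˡ` of `R(∂ᵢ, ∂ⱼ) ∂ₖ = ∇ᵢ ∇ⱼ ∂ₖ - ∇ⱼ ∇ᵢ ∂ₖ`. -/
def riemann (G : Plane → Matrix (Fin 2) (Fin 2) ℝ) (l i j k : Fin 2) (y : Plane) : ℝ :=
  partialDeriv i (christoffel G l j k) y - partialDeriv j (christoffel G l i k) y
    + ∑ m, (christoffel G m j k y * christoffel G l i m y
      - christoffel G m i k y * christoffel G l j m y)

/-- The Gaussian curvature `K = g(R(∂₀, ∂₁) ∂₁, ∂₀) / det (g_{ij})`. -/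
def coordGaussCurvature (G : Plane → Matrix (Fin 2) (Fin 2) ℝ) (y : Plane) : ℝ :=
  (∑ l, riemann G l 0 1 1 y * G y l 0) / (G y).det

/-- The matrix `D²u` of the Hessian, with entries `∂ᵢ ∂ⱼ u - ∑ₖ Γᵏᵢⱼ ∂ₖ u`. -/
def coordHessian (G : Plane → Matrix (Fin 2) (Fin 2) ℝ) (u : Plane → ℝ) (y : Plane) :
    Matrix (Fin 2) (Fin 2) ℝ :=
  Matrix.of fun i j => partialDeriv i (partialDeriv j u) y
    - ∑ k, christoffel G k i j y * partialDeriv k u y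

/-- The inner product `∑ᵢⱼ g_{ij} vⁱ wʲ`. -/
def coordInner (G : Plane → Matrix (Fin 2) (Fin 2) ℝ) (y : Plane) (v w : Fin 2 → ℝ) : ℝ :=
  v ⬝ᵥ (G y *ᵥ w)

/-- The gradient, with components `∑ⱼ gⁱʲ ∂ⱼ u`. -/
def coordGrad (G : Plane → Matrix (Fin 2) (Fin 2) ℝ) (u : Plane → ℝ) (y : Plane) : Fin 2 → ℝ :=
  (G y)⁻¹ *ᵥ fun j => partialDeriv j u y

/-- The rotation `J` by a right angle, positive for the orientation of the coordinates: for the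
area form `ω = √(det g) dy⁰ ∧ dy¹` it satisfies `ω(v, J w) = g(v, w)`. -/
def coordRotate (G : Plane → Matrix (Fin 2) (Fin 2) ℝ) (y : Plane) (v : Fin 2 → ℝ) :
    Fin 2 → ℝ :=
  (Real.sqrt (G y).det)⁻¹ • ![-(G y *ᵥ v) 1, (G y *ᵥ v) 0]

/-- The vector field `X = J ∇u` with stream function `u`. -/
def coordStreamField (G : Plane → Matrix (Fin 2) (Fin 2) ℝ) (u : Plane → ℝ) (y : Plane) :
    Fin 2 → ℝ :=
  coordRotate G y (coordGrad G u y)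

/-- The covariant derivative `∇_V W`, with components `∑ᵢ Vⁱ (∂ᵢ Wᵏ + ∑ⱼ Γᵏᵢⱼ Wʲ)`. -/
def coordCovDeriv (G : Plane → Matrix (Fin 2) (Fin 2) ℝ) (V W : Plane → Fin 2 → ℝ) (y : Plane) :
    Fin 2 → ℝ :=
  fun k => ∑ i, V y i * (partialDeriv i (fun z => W z k) y + ∑ j, christoffel G k i j y * W y j)

/-- On the line `y 0 = 0`, the unit normal to this line that points into the half plane `y 0 ≥ 0`:
it is `∇y⁰ / |∇y⁰|`, with components `gᵏ⁰ / √g⁰⁰`. -/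
def coordNormal (G : Plane → Matrix (Fin 2) (Fin 2) ℝ) (y : Plane) : Fin 2 → ℝ :=
  fun k => (G y)⁻¹ k 0 / Real.sqrt ((G y)⁻¹ 0 0)

/-- On the line `y 0 = 0`, its unit tangent field `T = ∂₁ / |∂₁|`. -/
def coordTangent (G : Plane → Matrix (Fin 2) (Fin 2) ℝ) (y : Plane) : Fin 2 → ℝ :=
  ![0, (Real.sqrt (G y 1 1))⁻¹]

/-- The geodesic curvature `g(∇_T T, n)` of the line `y 0 = 0`. -/
def coordGeodesicCurvature (G : Plane → Matrix (Fin 2) (Fin 2) ℝ) (y : Plane) : ℝ :=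
  coordInner G y (coordCovDeriv G (coordTangent G) (coordTangent G) y) (coordNormal G y)

/-! ### Surfaces with boundary

All the following notions at a point `p` are computed in the chart of `M` at `p`; they do not
depend on the choice of the chart. -/

/-- The smooth Riemannian metrics on a smooth surface with boundary. -/
abbrev Metric (M : Type*) [TopologicalSpace M] [ChartedSpace (EuclideanHalfSpace 2) M]
    [IsManifold (𝓡∂ 2) ∞ M] : Type _ :=
  Bundle.ContMDiffRiemannianMetric (𝓡∂ 2) ∞ Plane (fun p : M => TangentSpace (𝓡∂ 2) p)

variable {M : Type*} [TopologicalSpace M] [ChartedSpace (EuclideanHalfSpace 2) M]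
  [IsManifold (𝓡∂ 2) ∞ M]

/-- The coordinate vector `∂ᵢ` of the chart at `p`, at the point with coordinates `y`. -/
def chartVector (p : M) (i : Fin 2) (y : Plane) :
    TangentSpace (𝓡∂ 2) ((extChartAt (𝓡∂ 2) p).symm y) :=
  mfderivWithin 𝓘(ℝ, Plane) (𝓡∂ 2) (extChartAt (𝓡∂ 2) p).symm (Set.range (𝓡∂ 2)) y
    (EuclideanSpace.single i (1 : ℝ) : Plane)

/-- The matrix `g_{ij} = g(∂ᵢ, ∂ⱼ)` of the metric in the chart at `p`. -/
def chartMetric (g : Metric M) (p : M) (y : Plane) : Matrix (Fin 2) (Fin 2) ℝ :=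
  Matrix.of fun i j =>
    g.inner ((extChartAt (𝓡∂ 2) p).symm y) (chartVector p i y) (chartVector p j y)

/-- The coordinates of the point `p` in the chart at `p`. -/
def chartPoint (p : M) : Plane := extChartAt (𝓡∂ 2) p p

/-- The function `ψ` in the coordinates of the chart at `p`. -/
def chartFun (ψ : M → ℝ) (p : M) (y : Plane) : ℝ := ψ ((extChartAt (𝓡∂ 2) p).symm y)

/-- The Gaussian curvature `K` at `p`. -/
def gaussCurvature (g : Metric M) (p : M) : ℝ :=
  coordGaussCurvature (chartMetric g p) (chartPoint p)

/-- The geodesic curvature of the boundary, with respect to the inner normal, at a boundary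
point `p`. -/
def geodesicCurvature (g : Metric M) (p : M) : ℝ :=
  coordGeodesicCurvature (chartMetric g p) (chartPoint p)

/-- The Monge–Ampère equation `det [D²ψ] = (det (g_{ij}) · K / 2) |∇ψ|²` at the point `p`. -/
def MongeAmpereAt (g : Metric M) (ψ : M → ℝ) (p : M) : Prop :=
  (coordHessian (chartMetric g p) (chartFun ψ p) (chartPoint p)).det =
    (chartMetric g p (chartPoint p)).det * gaussCurvature g p / 2 *
      coordInner (chartMetric g p) (chartPoint p)
        (coordGrad (chartMetric g p) (chartFun ψ p) (chartPoint p))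
        (coordGrad (chartMetric g p) (chartFun ψ p) (chartPoint p))

/-- The boundary conditions `g(X, n) = g(∇_X X, n) = 0` at a boundary point `p`, where
`X = J ∇ψ`. Reversing the orientation replaces `X` by `-X` and does not affect them, so the
orientation given by the chart at `p` can be used. -/
def BoundaryConditionAt (g : Metric M) (ψ : M → ℝ) (p : M) : Prop :=
  coordInner (chartMetric g p) (chartPoint p)
      (coordStreamField (chartMetric g p) (chartFun ψ p) (chartPoint p))
      (coordNormal (chartMetric g p) (chartPoint p)) = 0 ∧
    coordInner (chartMetric g p) (chartPoint p)
      (coordCovDeriv (chartMetric g p) (coordStreamField (chartMetric g p) (chartFun ψ p))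
        (coordStreamField (chartMetric g p) (chartFun ψ p)) (chartPoint p))
      (coordNormal (chartMetric g p) (chartPoint p)) = 0

end SurfaceGeometry

end

/-!
The proof is a maximum principle for `N = |∇ψ|²`.

Metric compatibility of the Levi-Civita connection gives `dN = 2 D²ψ(∇ψ, ·)`
(`partialDeriv_coordGradNormSq`). At an interior maximum of `N` the vector `∇ψ` is therefore in the
kernel of `D²ψ`. If it were nonzero, `det D²ψ` would vanish, and the Monge–Ampère equation would
give `K |∇ψ|² = 0`, which is impossible as `K ≠ 0` (`gradNormSq_eq_zero_of_interior_max`).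

A maximum on the boundary is harmless, since `N` vanishes there. By `g(X, n) = 0` the field
`X = J∇ψ` is tangent to `∂M`, so `g(∇_X X, n) = |X|² k_g` and the second boundary condition gives
`X = 0` wherever `k_g ≠ 0` (`gradNormSq_eq_zero_of_geodesicCurvature_ne_zero`). The finitely many
remaining boundary points are limits of such points, and `N` is continuous
(`gradNormSq_eq_zero_of_mem_boundary`).

Since `M` is compact, `N` attains its maximum, so `N = 0`, and `ψ` is constant because `M` is
connected. The calculus takes place in single charts. Two facts pass between charts: `N` is
intrinsic, as `∇ψ` is dual to `dψ` (`coordGradNormSq_chart_eq`), and changes of charts preserve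
the tangent line of the boundary (`partialDeriv_one_chartFun_eq_zero`).
-/

noncomputable section

namespace SurfaceGeometry

open Filter Set Topology Bundle

/-! ### Partial derivatives in the half plane -/

lemma uniqueDiffWithinAt_halfPlane {y : Plane} (hy : y ∈ range (𝓡∂ 2)) :
    UniqueDiffWithinAt ℝ (range (𝓡∂ 2)) y :=
  (𝓡∂ 2).uniqueDiffOn y hy

section partialDeriv

variable {f h : Plane → ℝ} {y : Plane} (hy : y ∈ range (𝓡∂ 2))
  (hf : DifferentiableWithinAt ℝ f (range (𝓡∂ 2)) y)
  (hh : DifferentiableWithinAt ℝ h (range (𝓡∂ 2)) y) (i : Fin 2)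

include hy hf hh

lemma partialDeriv_add : partialDeriv i (fun z => f z + h z) y
    = partialDeriv i f y + partialDeriv i h y := by
  unfold partialDeriv
  rw [(hf.hasFDerivWithinAt.fun_add hh.hasFDerivWithinAt).fderivWithin
    (uniqueDiffWithinAt_halfPlane hy)]
  rfl

lemma partialDeriv_sub : partialDeriv i (fun z => f z - h z) y
    = partialDeriv i f y - partialDeriv i h y := by
  unfold partialDeriv
  rw [(hf.hasFDerivWithinAt.fun_sub hh.hasFDerivWithinAt).fderivWithin
    (uniqueDiffWithinAt_halfPlane hy)]
  rfl

lemma partialDeriv_mul : partialDeriv i (fun z => f z * h z) y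
    = partialDeriv i f y * h y + f y * partialDeriv i h y := by
  unfold partialDeriv
  rw [(hf.hasFDerivWithinAt.fun_mul hh.hasFDerivWithinAt).fderivWithin
    (uniqueDiffWithinAt_halfPlane hy)]
  simp
  ring

lemma partialDeriv_div (h0 : h y ≠ 0) : partialDeriv i (fun z => f z / h z) y
    = (partialDeriv i f y * h y - f y * partialDeriv i h y) / h y ^ 2 := by
  have key := partialDeriv_mul hy (f := fun z => f z / h z)
    (by simpa only [div_eq_mul_inv] using hf.fun_mul (hh.fun_inv h0)) hh i
  have hev : (fun z => f z / h z * h z) =ᶠ[𝓝[range (𝓡∂ 2)] y] f := by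
    filter_upwards [hh.continuousWithinAt.eventually_ne h0] with z hz
    field_simp
  have : partialDeriv i (fun z => f z / h z * h z) y = partialDeriv i f y := by
    unfold partialDeriv
    rw [hev.fderivWithin_eq_of_mem hy]
  rw [this] at key
  rw [key]
  field_simp
  ring

end partialDeriv

/-- A function that is constant along the boundary line has no derivative in the direction of that
line. Differentiability is not needed, since `partialDeriv` is zero where it fails. -/
lemma partialDeriv_one_eq_zero {f : Plane → ℝ} {y : Plane} (hy : y 0 = 0) (c : ℝ)
    (hf : ∀ᶠ z in 𝓝[range (𝓡∂ 2)] y, z 0 = 0 → f z = c) : partialDeriv 1 f y = 0 := by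
  unfold partialDeriv
  by_cases hd : DifferentiableWithinAt ℝ f (range (𝓡∂ 2)) y
  · have hline : HasDerivAt (fun t : ℝ => y + t • (EuclideanSpace.single 1 (1 : ℝ) : Plane))
        (EuclideanSpace.single 1 (1 : ℝ) : Plane) 0 := by
      simpa using ((hasDerivAt_id (0 : ℝ)).smul_const
        (EuclideanSpace.single 1 (1 : ℝ) : Plane)).const_add y
    have hmem : ∀ t : ℝ, (y + t • (EuclideanSpace.single 1 (1 : ℝ) : Plane)) 0 = 0 := by
      intro t; simp [hy]
    have hR : ∀ t : ℝ, y + t • (EuclideanSpace.single 1 (1 : ℝ) : Plane) ∈ range (𝓡∂ 2) := by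
      intro t
      rw [range_modelWithCornersEuclideanHalfSpace]
      exact (hmem t).ge
    have h0 : y + (0 : ℝ) • (EuclideanSpace.single 1 (1 : ℝ) : Plane) = y := by simp
    have hcomp : HasDerivAt (fun t : ℝ => f (y + t • (EuclideanSpace.single 1 (1 : ℝ) : Plane)))
        (fderivWithin ℝ f (range (𝓡∂ 2)) y (EuclideanSpace.single 1 1)) 0 := by
      have h1 := hd.hasFDerivWithinAt
      rw [← h0] at h1
      have := h1.comp_hasDerivWithinAt (s := univ) (0 : ℝ) hline.hasDerivWithinAt
        (fun t _ => hR t)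
      rw [h0] at this
      exact hasDerivWithinAt_univ.mp this
    have htend : Tendsto (fun t : ℝ => y + t • (EuclideanSpace.single 1 (1 : ℝ) : Plane)) (𝓝 0)
        (𝓝[range (𝓡∂ 2)] y) := by
      refine tendsto_nhdsWithin_iff.mpr ⟨?_, Eventually.of_forall hR⟩
      simpa [h0] using hline.continuousAt.tendsto
    have hconst : (fun t : ℝ => f (y + t • (EuclideanSpace.single 1 (1 : ℝ) : Plane)))
        =ᶠ[𝓝 0] fun _ => c := by
      filter_upwards [htend.eventually hf] with t ht using ht (hmem t)
    exact (hcomp.congr_of_eventuallyEq hconst.symm).unique (hasDerivAt_const 0 c)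
  · rw [fderivWithin_zero_of_not_differentiableWithinAt hd]
    rfl

lemma partialDeriv_const (i : Fin 2) (c : ℝ) (y : Plane) :
    partialDeriv i (fun _ => c) y = 0 := by
  simp [partialDeriv]

/-! ### The gradient in coordinates -/

section coordinates

variable {G : Plane → Matrix (Fin 2) (Fin 2) ℝ} {u : Plane → ℝ} {y : Plane}

/-- The squared length `|∇u|²` of the gradient, in coordinates. -/
def coordGradNormSq (G : Plane → Matrix (Fin 2) (Fin 2) ℝ) (u : Plane → ℝ) (y : Plane) : ℝ :=
  coordInner G y (coordGrad G u y) (coordGrad G u y)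

lemma mulVec_coordGrad (hdet : (G y).det ≠ 0) (i : Fin 2) :
    (G y *ᵥ coordGrad G u y) i = partialDeriv i u y := by
  rw [coordGrad, Matrix.mulVec_mulVec, Matrix.mul_nonsing_inv _ (Ne.isUnit hdet),
    Matrix.one_mulVec]

lemma inv_apply_eq (A : Matrix (Fin 2) (Fin 2) ℝ) :
    A⁻¹ = !![A 1 1 / A.det, -A 0 1 / A.det; -A 1 0 / A.det, A 0 0 / A.det] := by
  rw [Matrix.inv_def, Ring.inverse_eq_inv', Matrix.adjugate_fin_two]
  ext i j
  fin_cases i <;> fin_cases j <;> simp <;> ring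

/-- The formula holds for singular `G y` as well, where both sides are zero by convention. -/
lemma coordGradNormSq_eq (hs : ∀ i j, G y i j = G y j i) :
    coordGradNormSq G u y =
      (G y 1 1 * (partialDeriv 0 u y * partialDeriv 0 u y)
        - 2 * G y 0 1 * (partialDeriv 0 u y * partialDeriv 1 u y)
        + G y 0 0 * (partialDeriv 1 u y * partialDeriv 1 u y))
      / (G y 0 0 * G y 1 1 - G y 0 1 * G y 0 1) := by
  have hd : (G y).det = G y 0 0 * G y 1 1 - G y 0 1 * G y 0 1 := by
    rw [Matrix.det_fin_two, hs 1 0]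
  rw [← hd]
  simp only [coordGradNormSq, coordInner, coordGrad, inv_apply_eq, Matrix.mulVec,
    dotProduct, Fin.sum_univ_two, hs 1 0]
  simp
  by_cases h0 : (G y).det = 0
  · simp [h0]
  · field_simp
    rw [hd]
    ring

section critical

variable (hy : y ∈ range (𝓡∂ 2)) (hs : ∀ z i j, G z i j = G z j i) (hdet : (G y).det ≠ 0)
  (hG : ∀ i j, DifferentiableWithinAt ℝ (fun z => G z i j) (range (𝓡∂ 2)) y)
  (hu : ∀ i, DifferentiableWithinAt ℝ (partialDeriv i u) (range (𝓡∂ 2)) y)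

include hs hdet hG hu

lemma differentiableWithinAt_coordGradNormSq :
    DifferentiableWithinAt ℝ (coordGradNormSq G u) (range (𝓡∂ 2)) y := by
  have hd : G y 0 0 * G y 1 1 - G y 0 1 * G y 0 1 ≠ 0 := by
    rwa [Matrix.det_fin_two, hs y 1 0] at hdet
  rw [show coordGradNormSq G u = _ from funext fun z => coordGradNormSq_eq (hs z)]
  have := hG 0 0
  have := hG 0 1
  have := hG 1 1
  have := hu 0
  have := hu 1
  fun_prop (disch := assumption)

include hy

/-- Compatibility of the connection with the metric: `d |∇u|² = 2 D²u(∇u, ·)`. -/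
lemma partialDeriv_coordGradNormSq (i : Fin 2) :
    partialDeriv i (coordGradNormSq G u) y
      = 2 * (coordHessian G u y *ᵥ coordGrad G u y) i := by
  have hd : G y 0 0 * G y 1 1 - G y 0 1 * G y 0 1 ≠ 0 := by
    rwa [Matrix.det_fin_two, hs y 1 0] at hdet
  have hd' : (G y).det = G y 0 0 * G y 1 1 - G y 0 1 * G y 0 1 := by
    rw [Matrix.det_fin_two, hs y 1 0]
  have hsf : (fun z => G z 1 0) = fun z => G z 0 1 := funext fun z => hs z 1 0
  rw [show coordGradNormSq G u = _ from funext fun z => coordGradNormSq_eq (hs z)]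
  have h00 := hG 0 0
  have h01 := hG 0 1
  have h11 := hG 1 1
  have u0 := hu 0
  have u1 := hu 1
  have h2 : DifferentiableWithinAt ℝ (fun _ : Plane => (2 : ℝ)) (range (𝓡∂ 2)) y := by fun_prop
  rw [partialDeriv_div hy (by fun_prop) (by fun_prop) i hd,
    partialDeriv_add hy (by fun_prop) (by fun_prop),
    partialDeriv_sub hy (by fun_prop) (by fun_prop),
    partialDeriv_sub hy (by fun_prop) (by fun_prop),
    partialDeriv_mul hy h11 (by fun_prop),
    partialDeriv_mul hy (h2.fun_mul h01) (by fun_prop),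
    partialDeriv_mul hy h00 (by fun_prop),
    partialDeriv_mul hy h00 h11, partialDeriv_mul hy h01 h01, partialDeriv_mul hy h2 h01,
    partialDeriv_mul hy u0 u0, partialDeriv_mul hy u0 u1, partialDeriv_mul hy u1 u1,
    partialDeriv_const, ← hd']
  simp only [coordHessian, christoffel, coordGrad, inv_apply_eq, Matrix.mulVec,
    dotProduct, Fin.sum_univ_two, hs y 1 0, Matrix.of_apply, hsf]
  fin_cases i <;> simp <;> field_simp <;> rw [hd'] <;> ring

/-- At a critical point of `|∇u|²` the gradient lies in the kernel of the Hessian. -/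
lemma det_coordHessian_eq_zero (hcrit : ∀ i, partialDeriv i (coordGradNormSq G u) y = 0)
    (hne : coordGradNormSq G u y ≠ 0) : (coordHessian G u y).det = 0 := by
  refine Matrix.exists_mulVec_eq_zero_iff.mp ⟨coordGrad G u y, ?_, ?_⟩
  · intro h
    simp [coordGradNormSq, coordInner, h] at hne
  · ext i
    have := partialDeriv_coordGradNormSq hy hs hdet hG hu i
    rw [hcrit i] at this
    simpa using this.symm

end critical

/-! ### The boundary conditions in coordinates -/

lemma coordInner_coordNormal (hdet : (G y).det ≠ 0)
    (w : Fin 2 → ℝ) :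
    coordInner G y w (coordNormal G y) = w 0 / Real.sqrt ((G y)⁻¹ 0 0) := by
  have hn : coordNormal G y = (Real.sqrt ((G y)⁻¹ 0 0))⁻¹ • ((G y)⁻¹ *ᵥ Pi.single 0 1) := by
    ext k
    simp [coordNormal, div_eq_inv_mul]
  rw [coordInner, hn, Matrix.mulVec_smul, Matrix.mulVec_mulVec,
    Matrix.mul_nonsing_inv _ (Ne.isUnit hdet)]
  simp [div_eq_inv_mul]

lemma coordStreamField_zero (hdet : (G y).det ≠ 0) :
    coordStreamField G u y 0 = -((Real.sqrt (G y).det)⁻¹ * partialDeriv 1 u y) := by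
  simp [coordStreamField, coordRotate, mulVec_coordGrad hdet]

lemma coordStreamField_one (hdet : (G y).det ≠ 0) :
    coordStreamField G u y 1 = (Real.sqrt (G y).det)⁻¹ * partialDeriv 0 u y := by
  simp [coordStreamField, coordRotate, mulVec_coordGrad hdet]

/-- For a field tangent to the boundary line, only `Γ⁰₁₁` contributes to the normal component of
its covariant derivative along itself. -/
lemma coordCovDeriv_zero {W : Plane → Fin 2 → ℝ} (h0 : W y 0 = 0)
    (h1 : partialDeriv 1 (fun z => W z 0) y = 0) :
    coordCovDeriv G W W y 0 = christoffel G 0 1 1 y * W y 1 ^ 2 := by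
  simp [coordCovDeriv, Fin.sum_univ_two, h0, h1]
  ring

/-- The condition `g(X, n) = 0` says that `u` has no derivative along the boundary. -/
lemma partialDeriv_one_eq_zero_of_tangent (hpos : (G y).PosDef)
    (h : coordInner G y (coordStreamField G u y) (coordNormal G y) = 0) :
    partialDeriv 1 u y = 0 := by
  have hdet := hpos.det_pos
  have hn : 0 < (G y)⁻¹ 0 0 := hpos.inv.diag_pos
  rw [coordInner_coordNormal hdet.ne', coordStreamField_zero hdet.ne'] at h
  have h1 := (Real.sqrt_pos.mpr hdet).ne'
  have h2 := (Real.sqrt_pos.mpr hn).ne'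
  simpa [h1, h2] using h

/-- Where the boundary is not geodesic, a field that is tangent to it and whose self-derivative is
tangent to it vanishes: along the boundary `g(∇_X X, n) = |X|² k_g`. -/
lemma partialDeriv_zero_eq_zero_of_tangent (hpos : (G y).PosDef) (hy : y 0 = 0)
    (hline : ∀ᶠ z in 𝓝[range (𝓡∂ 2)] y, z 0 = 0 → (G z).det ≠ 0 ∧ partialDeriv 1 u z = 0)
    (h : coordInner G y (coordCovDeriv G (coordStreamField G u) (coordStreamField G u) y)
      (coordNormal G y) = 0)
    (hk : coordGeodesicCurvature G y ≠ 0) : partialDeriv 0 u y = 0 := by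
  have hdet := hpos.det_pos
  have hn : 0 < (G y)⁻¹ 0 0 := hpos.inv.diag_pos
  have h1 := (Real.sqrt_pos.mpr hdet).ne'
  have h2 := (Real.sqrt_pos.mpr hn).ne'
  have hyR : y ∈ range (𝓡∂ 2) := by
    rw [range_modelWithCornersEuclideanHalfSpace]
    exact hy.ge
  have hX : ∀ᶠ z in 𝓝[range (𝓡∂ 2)] y, z 0 = 0 → coordStreamField G u z 0 = 0 := by
    filter_upwards [hline] with z hz hz0
    rw [coordStreamField_zero (hz hz0).1, (hz hz0).2]
    simp
  have hΓ : christoffel G 0 1 1 y ≠ 0 := by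
    intro h0
    apply hk
    rw [coordGeodesicCurvature, coordInner_coordNormal hdet.ne',
      coordCovDeriv_zero (by simp [coordTangent])
        (by simpa [coordTangent] using partialDeriv_const 1 0 y), h0]
    simp
  rw [coordInner_coordNormal hdet.ne',
    coordCovDeriv_zero (hX.self_of_nhdsWithin hyR hy) (partialDeriv_one_eq_zero hy 0 hX),
    coordStreamField_one hdet.ne'] at h
  simpa [h1, h2, hΓ] using h

end coordinates

section surface

variable {M : Type*} [TopologicalSpace M] [ChartedSpace (EuclideanHalfSpace 2) M]
  [IsManifold (𝓡∂ 2) ∞ M]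

/-! ### The metric and the gradient in a chart -/

variable (g : Metric M) {ψ : M → ℝ} {p q : M} {y : Plane}

omit [IsManifold (𝓡∂ 2) ∞ M] in
lemma target_mem_nhdsWithin_range (hy : y ∈ (extChartAt (𝓡∂ 2) p).target) :
    (extChartAt (𝓡∂ 2) p).target ∈ 𝓝[range (𝓡∂ 2)] y :=
  extChartAt_target_mem_nhdsWithin_of_mem hy

omit [IsManifold (𝓡∂ 2) ∞ M] in
lemma target_subset_range : (extChartAt (𝓡∂ 2) p).target ⊆ range (𝓡∂ 2) :=
  extChartAt_target_subset_range p

lemma chartMetric_symm (z : Plane) (i j : Fin 2) :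
    chartMetric g p z i j = chartMetric g p z j i :=
  g.symm _ _ _

omit [IsManifold (𝓡∂ 2) ∞ M] in
lemma sum_smul_chartVector (v : Fin 2 → ℝ) :
    ∑ i, v i • chartVector p i y
      = mfderivWithin 𝓘(ℝ, Plane) (𝓡∂ 2) (extChartAt (𝓡∂ 2) p).symm (range (𝓡∂ 2)) y
        (WithLp.toLp 2 v : Plane) := by
  have hv : (WithLp.toLp 2 v : Plane) = ∑ i, v i • (EuclideanSpace.single i (1 : ℝ) : Plane) := by
    ext j
    fin_cases j <;> simp [Fin.sum_univ_two]
  rw [hv]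
  simp only [chartVector]
  exact ((map_sum (mfderivWithin 𝓘(ℝ, Plane) (𝓡∂ 2) (extChartAt (𝓡∂ 2) p).symm
    (range (𝓡∂ 2)) y) _ _).trans (Finset.sum_congr rfl fun i _ => map_smul _ _ _)).symm

lemma bilin_sum_smul {V : Type*} [AddCommGroup V] [TopologicalSpace V] [Module ℝ V]
    [IsTopologicalAddGroup V] [ContinuousSMul ℝ V] (B : V →L[ℝ] V →L[ℝ] ℝ) (e : Fin 2 → V)
    (v w : Fin 2 → ℝ) :
    B (∑ i, v i • e i) (∑ i, w i • e i) = ∑ i, v i * ∑ j, B (e i) (e j) * w j := by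
  simp [Fin.sum_univ_two]
  ring

lemma inner_sum_smul_chartVector (v w : Fin 2 → ℝ) :
    g.inner ((extChartAt (𝓡∂ 2) p).symm y) (∑ i, v i • chartVector p i y)
      (∑ i, w i • chartVector p i y) = coordInner (chartMetric g p) y v w := by
  simp only [coordInner, Matrix.mulVec, dotProduct, chartMetric, Matrix.of_apply]
  exact bilin_sum_smul _ _ v w

lemma posDef_chartMetric (hy : y ∈ (extChartAt (𝓡∂ 2) p).target) :
    (chartMetric g p y).PosDef := by
  refine Matrix.PosDef.of_dotProduct_mulVec_pos ?_ ?_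
  · ext i j
    simp [chartMetric_symm g y i j]
  · intro v hv
    have h := inner_sum_smul_chartVector g (p := p) (y := y) v v
    simp only [star_trivial]
    change 0 < coordInner (chartMetric g p) y v v
    rw [← h, sum_smul_chartVector]
    refine g.pos _ _ ?_
    intro h0
    have hinj := (isInvertible_mfderivWithin_extChartAt_symm hy).injective
    have := hinj (h0.trans (map_zero _).symm)
    apply hv
    exact congrArg (fun x : Plane => WithLp.ofLp x) this

lemma contDiffOn_chartMetric (i j : Fin 2) :
    ContDiffOn ℝ ∞ (fun y => chartMetric g p y i j) (extChartAt (𝓡∂ 2) p).target := by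
  -- in the trivialization of the tangent bundle at `p` the coordinate vectors are constant
  have hsec : ∀ i, ContMDiffOn (𝓡∂ 2) ((𝓡∂ 2).prod 𝓘(ℝ, Plane)) ∞
      (fun q => TotalSpace.mk' Plane (E := fun q : M => TangentSpace (𝓡∂ 2) q) q
        ((trivializationAt Plane (TangentSpace (𝓡∂ 2)) p).symmL ℝ q
          (EuclideanSpace.single i (1 : ℝ) : Plane))) (chartAt (EuclideanHalfSpace 2) p).source := by
    intro i
    let e := trivializationAt Plane (TangentSpace (𝓡∂ 2) (M := M)) p
    have hb : e.baseSet = (chartAt (EuclideanHalfSpace 2) p).source := rfl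
    rw [← hb, e.contMDiffOn_section_baseSet_iff]
    refine (contMDiffOn_const (c := (EuclideanSpace.single i (1 : ℝ) : Plane))).congr ?_
    intro q hq
    change (e ⟨q, e.symmL ℝ q _⟩).2 = _
    rw [e.symmL_apply hq, e.apply_mk_symm hq]
  have hreal : ContMDiffOn (𝓡∂ 2) 𝓘(ℝ, ℝ) ∞ (fun q => g.inner q
        ((trivializationAt Plane (TangentSpace (𝓡∂ 2)) p).symmL ℝ q
          (EuclideanSpace.single i (1 : ℝ) : Plane))
        ((trivializationAt Plane (TangentSpace (𝓡∂ 2)) p).symmL ℝ q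
          (EuclideanSpace.single j (1 : ℝ) : Plane))) (chartAt (EuclideanHalfSpace 2) p).source := by
    intro q hq
    have : ContMDiffWithinAt (𝓡∂ 2) ((𝓡∂ 2).prod 𝓘(ℝ)) ∞
        (fun m ↦ TotalSpace.mk' ℝ (E := Bundle.Trivial M ℝ) m (g.inner m
        ((trivializationAt Plane (TangentSpace (𝓡∂ 2)) p).symmL ℝ m
          (EuclideanSpace.single i (1 : ℝ) : Plane))
        ((trivializationAt Plane (TangentSpace (𝓡∂ 2)) p).symmL ℝ m
          (EuclideanSpace.single j (1 : ℝ) : Plane)))) (chartAt (EuclideanHalfSpace 2) p).source q :=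
      ContMDiffWithinAt.clm_bundle_apply₂ (F₁ := Plane) (F₂ := Plane)
        g.contMDiff.contMDiffAt.contMDiffWithinAt (hsec i q hq) (hsec j q hq)
    simp only [contMDiffWithinAt_totalSpace] at this
    exact this.2
  rw [← contMDiffOn_iff_contDiffOn]
  refine (hreal.comp (contMDiffOn_extChartAt_symm p) ?_).congr ?_
  · intro y hy
    simpa using (extChartAt (𝓡∂ 2) p).map_target hy
  · intro y hy
    have hsrc : (extChartAt (𝓡∂ 2) p).symm y ∈ (chartAt (EuclideanHalfSpace 2) p).source := by
      simpa using (extChartAt (𝓡∂ 2) p).map_target hy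
    simp only [Function.comp, chartMetric, Matrix.of_apply, chartVector]
    rw [TangentBundle.symmL_trivializationAt hsrc, (extChartAt (𝓡∂ 2) p).right_inv hy]
    rfl

lemma differentiableWithinAt_chartMetric (hy : y ∈ (extChartAt (𝓡∂ 2) p).target) (i j : Fin 2) :
    DifferentiableWithinAt ℝ (fun z => chartMetric g p z i j) (range (𝓡∂ 2)) y :=
  ((contDiffOn_chartMetric g i j y hy).differentiableWithinAt (by simp)).mono_of_mem_nhdsWithin
    (target_mem_nhdsWithin_range hy)

lemma contDiffWithinAt_chartFun (hψ : ContMDiff (𝓡∂ 2) 𝓘(ℝ, ℝ) 2 ψ)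
    (hy : y ∈ (extChartAt (𝓡∂ 2) p).target) :
    ContDiffWithinAt ℝ 2 (chartFun ψ p) (range (𝓡∂ 2)) y := by
  have h1 : ContMDiffOn 𝓘(ℝ, Plane) 𝓘(ℝ, ℝ) 2 (chartFun ψ p) (extChartAt (𝓡∂ 2) p).target :=
    hψ.comp_contMDiffOn ((contMDiffOn_extChartAt_symm (n := ∞) p).of_le (by norm_cast))
  rw [contMDiffOn_iff_contDiffOn] at h1
  exact (h1 y hy).mono_of_mem_nhdsWithin (target_mem_nhdsWithin_range hy)

lemma differentiableWithinAt_partialDeriv_chartFun (hψ : ContMDiff (𝓡∂ 2) 𝓘(ℝ, ℝ) 2 ψ)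
    (hy : y ∈ (extChartAt (𝓡∂ 2) p).target) (i : Fin 2) :
    DifferentiableWithinAt ℝ (partialDeriv i (chartFun ψ p)) (range (𝓡∂ 2)) y := by
  have h1 : ContDiffWithinAt ℝ 1 (fderivWithin ℝ (chartFun ψ p) (range (𝓡∂ 2)))
      (range (𝓡∂ 2)) y :=
    (contDiffWithinAt_chartFun hψ hy).fderivWithin_right (𝓡∂ 2).uniqueDiffOn (by norm_num)
      (target_subset_range hy)
  exact (h1.differentiableWithinAt (by simp)).clm_apply (differentiableWithinAt_const _)

lemma partialDeriv_chartFun (hψ : ContMDiff (𝓡∂ 2) 𝓘(ℝ, ℝ) 2 ψ)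
    (hy : y ∈ (extChartAt (𝓡∂ 2) p).target) (i : Fin 2) :
    partialDeriv i (chartFun ψ p) y
      = mfderiv (𝓡∂ 2) 𝓘(ℝ, ℝ) ψ ((extChartAt (𝓡∂ 2) p).symm y) (chartVector p i y) := by
  have h := mfderiv_comp_mfderivWithin (I := 𝓘(ℝ, Plane)) (I' := 𝓡∂ 2) (I'' := 𝓘(ℝ, ℝ)) y
    (g := ψ) (f := (extChartAt (𝓡∂ 2) p).symm) (s := range (𝓡∂ 2))
    ((hψ _).mdifferentiableAt (by simp)) (mdifferentiableWithinAt_extChartAt_symm hy)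
    ((𝓡∂ 2).uniqueDiffOn y (target_subset_range hy)).uniqueMDiffWithinAt
  rw [mfderivWithin_eq_fderivWithin] at h
  exact DFunLike.congr_fun h (EuclideanSpace.single i (1 : ℝ) : Plane)

/-- The gradient is the vector dual to `dψ`, so its length does not depend on coordinates. -/
lemma exists_gradient (hψ : ContMDiff (𝓡∂ 2) 𝓘(ℝ, ℝ) 2 ψ)
    (hy : y ∈ (extChartAt (𝓡∂ 2) p).target) :
    ∃ w : TangentSpace (𝓡∂ 2) ((extChartAt (𝓡∂ 2) p).symm y),
      (∀ v, g.inner ((extChartAt (𝓡∂ 2) p).symm y) w v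
        = mfderiv (𝓡∂ 2) 𝓘(ℝ, ℝ) ψ ((extChartAt (𝓡∂ 2) p).symm y) v) ∧
      coordGradNormSq (chartMetric g p) (chartFun ψ p) y
        = g.inner ((extChartAt (𝓡∂ 2) p).symm y) w w := by
  refine ⟨∑ i, coordGrad (chartMetric g p) (chartFun ψ p) y i • chartVector p i y, ?_, ?_⟩
  · intro v
    obtain ⟨x, hx⟩ := (isInvertible_mfderivWithin_extChartAt_symm hy).surjective v
    have hx' : v = ∑ i, (WithLp.ofLp (x : Plane)) i • chartVector p i y := by
      rw [sum_smul_chartVector, ← hx]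
      rfl
    have hdet := (posDef_chartMetric g hy).det_pos.ne'
    rw [hx', g.symm, inner_sum_smul_chartVector, coordInner,
      funext fun i => mulVec_coordGrad (u := chartFun ψ p) hdet i]
    rw [map_sum]
    simp only [dotProduct, partialDeriv_chartFun hψ hy, map_smul]
    rfl
  · rw [inner_sum_smul_chartVector]
    rfl

/-- The function `|∇ψ|²` on the surface, computed at each point in the chart at that point. -/
def gradNormSq (ψ : M → ℝ) (p : M) : ℝ :=
  coordGradNormSq (chartMetric g p) (chartFun ψ p) (chartPoint p)

lemma exists_gradient_of_mem_source (hψ : ContMDiff (𝓡∂ 2) 𝓘(ℝ, ℝ) 2 ψ)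
    (hq : q ∈ (extChartAt (𝓡∂ 2) p).source) :
    ∃ w : TangentSpace (𝓡∂ 2) q,
      (∀ v, g.inner q w v = mfderiv (𝓡∂ 2) 𝓘(ℝ, ℝ) ψ q v) ∧
      coordGradNormSq (chartMetric g p) (chartFun ψ p) (extChartAt (𝓡∂ 2) p q)
        = g.inner q w w := by
  have h := exists_gradient g hψ ((extChartAt (𝓡∂ 2) p).map_source hq)
  rwa [(extChartAt (𝓡∂ 2) p).left_inv hq] at h

/-- The length of the gradient can be computed in any chart. -/
lemma coordGradNormSq_chart_eq (hψ : ContMDiff (𝓡∂ 2) 𝓘(ℝ, ℝ) 2 ψ)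
    (hq : q ∈ (extChartAt (𝓡∂ 2) p).source) :
    coordGradNormSq (chartMetric g p) (chartFun ψ p) (extChartAt (𝓡∂ 2) p q)
      = gradNormSq g ψ q := by
  obtain ⟨w, hw, h⟩ := exists_gradient_of_mem_source g hψ hq
  obtain ⟨w', hw', h'⟩ := exists_gradient_of_mem_source g hψ (mem_extChartAt_source (I := 𝓡∂ 2) q)
  rw [h]
  refine Eq.trans ?_ h'.symm
  rw [hw, ← hw', g.symm, hw, ← hw']

lemma differentiableWithinAt_chart_coordGradNormSq (hψ : ContMDiff (𝓡∂ 2) 𝓘(ℝ, ℝ) 2 ψ)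
    (hy : y ∈ (extChartAt (𝓡∂ 2) p).target) :
    DifferentiableWithinAt ℝ (coordGradNormSq (chartMetric g p) (chartFun ψ p))
      (range (𝓡∂ 2)) y :=
  differentiableWithinAt_coordGradNormSq (chartMetric_symm g)
    (posDef_chartMetric g hy).det_pos.ne' (differentiableWithinAt_chartMetric g hy)
    (differentiableWithinAt_partialDeriv_chartFun hψ hy)

lemma continuous_gradNormSq (hψ : ContMDiff (𝓡∂ 2) 𝓘(ℝ, ℝ) 2 ψ) :
    Continuous (gradNormSq g ψ) := by
  rw [continuous_iff_continuousAt]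
  intro p
  have hsrc : (extChartAt (𝓡∂ 2) p).source ∈ 𝓝 p := extChartAt_source_mem_nhds p
  have h1 : ContinuousWithinAt (coordGradNormSq (chartMetric g p) (chartFun ψ p))
      (range (𝓡∂ 2)) (extChartAt (𝓡∂ 2) p p) :=
    (differentiableWithinAt_chart_coordGradNormSq g hψ
      (mem_extChartAt_target p)).continuousWithinAt
  have h2 : Tendsto (extChartAt (𝓡∂ 2) p) (𝓝 p)
      (𝓝[range (𝓡∂ 2)] (extChartAt (𝓡∂ 2) p p)) :=
    tendsto_nhdsWithin_iff.mpr ⟨continuousAt_extChartAt p, Eventually.of_forall fun q =>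
      mem_range_self (chartAt (EuclideanHalfSpace 2) p q)⟩
  refine Tendsto.congr' ?_ (h1.tendsto.comp h2)
  filter_upwards [hsrc] with q hq using coordGradNormSq_chart_eq g hψ hq

lemma gradNormSq_nonneg (hψ : ContMDiff (𝓡∂ 2) 𝓘(ℝ, ℝ) 2 ψ) (p : M) : 0 ≤ gradNormSq g ψ p := by
  obtain ⟨w, -, h⟩ := exists_gradient_of_mem_source g hψ (mem_extChartAt_source (I := 𝓡∂ 2) p)
  change 0 ≤ coordGradNormSq (chartMetric g p) (chartFun ψ p) (extChartAt (𝓡∂ 2) p p)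
  rw [h]
  by_cases hw : w = 0
  · simp [hw]
  · exact (g.pos p w hw).le

/-! ### The boundary -/

omit [IsManifold (𝓡∂ 2) ∞ M] in
lemma chartPoint_zero (hp : p ∈ (𝓡∂ 2).boundary M) : chartPoint p 0 = 0 := by
  have h : extChartAt (𝓡∂ 2) p p ∈ frontier (range (𝓡∂ 2)) := hp
  rw [frontier_range_modelWithCornersEuclideanHalfSpace] at h
  exact h.symm

lemma mem_boundary_iff (hq : q ∈ (extChartAt (𝓡∂ 2) p).source) :
    q ∈ (𝓡∂ 2).boundary M ↔ extChartAt (𝓡∂ 2) p q 0 = 0 := by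
  have hq' : q ∈ (chartAt (EuclideanHalfSpace 2) p).source := by simpa using hq
  have hR : extChartAt (𝓡∂ 2) p q ∈ range (𝓡∂ 2) := mem_range_self _
  have hint : (𝓡∂ 2).IsInteriorPoint q ↔ 0 < extChartAt (𝓡∂ 2) p q 0 := by
    rw [(𝓡∂ 2).isInteriorPoint_iff_of_mem_atlas (n := 1) (by simp) (chart_mem_atlas _ p) hq']
    constructor
    · intro h
      have := OpenPartialHomeomorph.interior_extend_target_subset_interior_range _ h
      rwa [interior_range_modelWithCornersEuclideanHalfSpace] at this
    · intro h
      refine (chartAt (EuclideanHalfSpace 2) p).mem_interior_extend_target ?_ ?_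
      · exact (chartAt (EuclideanHalfSpace 2) p).map_source hq'
      · rwa [interior_range_modelWithCornersEuclideanHalfSpace]
  have hbd : q ∈ (𝓡∂ 2).boundary M ↔ ¬ (𝓡∂ 2).IsInteriorPoint q :=
    (𝓡∂ 2).isBoundaryPoint_iff_not_isInteriorPoint q
  rw [range_modelWithCornersEuclideanHalfSpace] at hR
  rw [hbd, hint, not_lt]
  exact ⟨fun h => le_antisymm h hR, fun h => h.le⟩

/-- Changes of charts preserve the boundary line, hence also its tangent direction: the vanishing
of the derivative along the boundary does not depend on the chart. -/
lemma partialDeriv_one_chartFun_eq_zero (hψ : ContMDiff (𝓡∂ 2) 𝓘(ℝ, ℝ) 2 ψ)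
    (hq : q ∈ (extChartAt (𝓡∂ 2) p).source) (hqb : q ∈ (𝓡∂ 2).boundary M)
    (h : partialDeriv 1 (chartFun ψ q) (chartPoint q) = 0) :
    partialDeriv 1 (chartFun ψ p) (extChartAt (𝓡∂ 2) p q) = 0 := by
  set z := extChartAt (𝓡∂ 2) p q with hz
  have hzt : z ∈ (extChartAt (𝓡∂ 2) p).target := (extChartAt (𝓡∂ 2) p).map_source hq
  have hzR := target_subset_range hzt
  have hzq : (extChartAt (𝓡∂ 2) p).symm z = q := (extChartAt (𝓡∂ 2) p).left_inv hq
  set τ : Plane → Plane := fun x => extChartAt (𝓡∂ 2) q ((extChartAt (𝓡∂ 2) p).symm x) with hτ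
  have hτz : τ z = chartPoint q := by simp only [hτ, hzq]; rfl
  -- near `z` the chart at `q` is defined on the points of the chart at `p`
  have hev : ∀ᶠ x in 𝓝[range (𝓡∂ 2)] z, x ∈ (extChartAt (𝓡∂ 2) p).target ∧
      (extChartAt (𝓡∂ 2) p).symm x ∈ (extChartAt (𝓡∂ 2) q).source := by
    refine (eventually_mem_set.mpr (target_mem_nhdsWithin_range hzt)).and ?_
    have hc : ContinuousWithinAt (extChartAt (𝓡∂ 2) p).symm (range (𝓡∂ 2)) z :=
      (continuousAt_extChartAt_symm'' hzt).continuousWithinAt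
    apply hc.eventually_mem
    rw [hzq]
    exact extChartAt_source_mem_nhds q
  have hτd : DifferentiableWithinAt ℝ τ (range (𝓡∂ 2)) z := by
    have h1 : MDifferentiableWithinAt 𝓘(ℝ, Plane) 𝓘(ℝ, Plane) τ (range (𝓡∂ 2)) z := by
      refine MDifferentiableAt.comp_mdifferentiableWithinAt (I' := 𝓡∂ 2) z ?_
        (mdifferentiableWithinAt_extChartAt_symm hzt)
      rw [hzq]
      exact mdifferentiableAt_extChartAt (mem_chart_source _ q)
    exact h1.differentiableWithinAt
  -- `τ` maps the boundary line to itself, so it preserves the direction `∂₁`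
  have hτ0 : (fderivWithin ℝ τ (range (𝓡∂ 2)) z (EuclideanSpace.single 1 1)) 0 = 0 := by
    have h1 : partialDeriv 1 (fun x => τ x 0) z = 0 := by
      refine partialDeriv_one_eq_zero ((mem_boundary_iff hq).mp hqb) 0 ?_
      filter_upwards [hev] with x hx hx0
      refine (mem_boundary_iff hx.2).mp
        ((mem_boundary_iff ((extChartAt (𝓡∂ 2) p).map_target hx.1)).mpr ?_)
      rwa [(extChartAt (𝓡∂ 2) p).right_inv hx.1]
    rw [← h1, partialDeriv]
    have h2 := (EuclideanSpace.proj (𝕜 := ℝ) (0 : Fin 2)).hasFDerivAt.comp_hasFDerivWithinAt z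
      hτd.hasFDerivWithinAt
    have h3 := h2.fderivWithin (uniqueDiffWithinAt_halfPlane hzR)
    exact (DFunLike.congr_fun h3 (EuclideanSpace.single 1 1)).symm
  have hu : DifferentiableWithinAt ℝ (chartFun ψ q) (range (𝓡∂ 2)) (τ z) := by
    rw [hτz]
    exact (contDiffWithinAt_chartFun hψ (mem_extChartAt_target q)).differentiableWithinAt (by simp)
  have hcomp := hu.hasFDerivWithinAt.comp z hτd.hasFDerivWithinAt
    (fun x _ => mem_range_self _)
  have heq : chartFun ψ p =ᶠ[𝓝[range (𝓡∂ 2)] z] chartFun ψ q ∘ τ := by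
    filter_upwards [hev] with x hx
    simp only [Function.comp, chartFun, hτ]
    rw [(extChartAt (𝓡∂ 2) q).left_inv hx.2]
  set v := fderivWithin ℝ τ (range (𝓡∂ 2)) z (EuclideanSpace.single 1 1) with hv
  have hv1 : v = v 1 • (EuclideanSpace.single 1 (1 : ℝ) : Plane) := by
    ext j
    fin_cases j
    · simpa using hτ0
    · simp
  rw [partialDeriv, heq.fderivWithin_eq_of_mem hzR,
    hcomp.fderivWithin (uniqueDiffWithinAt_halfPlane hzR)]
  change fderivWithin ℝ (chartFun ψ q) (range (𝓡∂ 2)) (τ z) v = 0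
  rw [hv1, map_smul, hτz]
  simp only [partialDeriv] at h
  rw [h, smul_zero]

/-- The boundary has no isolated points. -/
lemma mem_closure_boundary_diff_finite [T1Space M] (hp : p ∈ (𝓡∂ 2).boundary M) {S : Set M}
    (hS : S.Finite) : p ∈ closure ((𝓡∂ 2).boundary M \ S) := by
  -- `p` is approached along the boundary line of the chart at `p`
  set c : ℝ → Plane := fun t => chartPoint p + t • (EuclideanSpace.single 1 (1 : ℝ) : Plane)
    with hc
  have hc0 : ∀ t, c t 0 = 0 := by
    intro t
    simp [hc, chartPoint_zero hp]
  have hcont : Tendsto c (𝓝[≠] 0) (𝓝[range (𝓡∂ 2)] (chartPoint p)) := by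
    refine tendsto_nhdsWithin_iff.mpr ⟨?_, Eventually.of_forall fun t => ?_⟩
    · have h1 : Continuous c := by fun_prop
      have h2 := h1.tendsto 0
      simp only [hc, zero_smul, add_zero] at h2
      exact h2.mono_left nhdsWithin_le_nhds
    · rw [range_modelWithCornersEuclideanHalfSpace]
      exact (hc0 t).ge
  have hsymm : Tendsto (fun t => (extChartAt (𝓡∂ 2) p).symm (c t)) (𝓝[≠] 0) (𝓝 p) := by
    have h1 := continuousAt_extChartAt_symm (I := 𝓡∂ 2) p
    have h2 := h1.tendsto.comp (hcont.mono_right nhdsWithin_le_nhds)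
    rwa [extChartAt_to_inv] at h2
  refine mem_closure_of_tendsto hsymm ?_
  have hS' : (S \ {p})ᶜ ∈ 𝓝 p := hS.sdiff.isClosed.isOpen_compl.mem_nhds (by simp)
  filter_upwards [hcont.eventually (eventually_mem_set.mpr
    (target_mem_nhdsWithin_range (mem_extChartAt_target p))), hsymm.eventually_mem hS',
    self_mem_nhdsWithin] with t ht htS ht0
  have hinv := (extChartAt (𝓡∂ 2) p).right_inv ht
  refine ⟨?_, fun hmem => htS ⟨hmem, fun heq => ht0 ?_⟩⟩
  · rw [mem_boundary_iff ((extChartAt (𝓡∂ 2) p).map_target ht), hinv, hc0]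
  · rw [mem_singleton_iff.mp heq] at hinv
    have h1 := congrArg (fun x : Plane => x 1) hinv
    simpa [hc, chartPoint] using h1

/-- By `g(X, n) = 0` the field `X` is tangent to the boundary, so that `g(∇_X X, n) = |X|² k_g`. -/
lemma gradNormSq_eq_zero_of_geodesicCurvature_ne_zero (hψ : ContMDiff (𝓡∂ 2) 𝓘(ℝ, ℝ) 2 ψ)
    (hBC : ∀ p ∈ (𝓡∂ 2).boundary M, BoundaryConditionAt g ψ p) (hp : p ∈ (𝓡∂ 2).boundary M)
    (hk : geodesicCurvature g p ≠ 0) : gradNormSq g ψ p = 0 := by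
  have hone : ∀ q ∈ (𝓡∂ 2).boundary M, partialDeriv 1 (chartFun ψ q) (chartPoint q) = 0 :=
    fun q hq => partialDeriv_one_eq_zero_of_tangent
      (posDef_chartMetric g (mem_extChartAt_target q)) (hBC q hq).1
  have hzero : partialDeriv 0 (chartFun ψ p) (chartPoint p) = 0 := by
    refine partialDeriv_zero_eq_zero_of_tangent
      (posDef_chartMetric g (mem_extChartAt_target p)) (chartPoint_zero hp) ?_ (hBC p hp).2 hk
    filter_upwards [target_mem_nhdsWithin_range (mem_extChartAt_target p)] with z hz hz0
    refine ⟨(posDef_chartMetric g hz).det_pos.ne', ?_⟩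
    have hsrc := (extChartAt (𝓡∂ 2) p).map_target hz
    have hinv := (extChartAt (𝓡∂ 2) p).right_inv hz
    have hb : (extChartAt (𝓡∂ 2) p).symm z ∈ (𝓡∂ 2).boundary M := by
      rwa [mem_boundary_iff hsrc, hinv]
    have h := partialDeriv_one_chartFun_eq_zero hψ hsrc hb (hone _ hb)
    rwa [hinv] at h
  rw [gradNormSq, coordGradNormSq_eq (chartMetric_symm g _), hzero, hone p hp]
  simp

lemma gradNormSq_eq_zero_of_mem_boundary [T1Space M] (hψ : ContMDiff (𝓡∂ 2) 𝓘(ℝ, ℝ) 2 ψ)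
    (hk : {p : M | p ∈ (𝓡∂ 2).boundary M ∧ geodesicCurvature g p = 0}.Finite)
    (hBC : ∀ p ∈ (𝓡∂ 2).boundary M, BoundaryConditionAt g ψ p) (hp : p ∈ (𝓡∂ 2).boundary M) :
    gradNormSq g ψ p = 0 := by
  have hclosed : IsClosed {q : M | gradNormSq g ψ q = 0} :=
    isClosed_singleton.preimage (continuous_gradNormSq g hψ)
  -- every boundary point is a limit of boundary points with `k_g ≠ 0`
  refine hclosed.closure_subset_iff.mpr ?_ (mem_closure_boundary_diff_finite hp hk)
  rintro q ⟨hq, hqk⟩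
  exact gradNormSq_eq_zero_of_geodesicCurvature_ne_zero g hψ hBC hq fun h => hqk ⟨hq, h⟩

/-! ### The interior -/

/-- At an interior maximum of `|∇ψ|²` the Hessian annihilates `∇ψ`, and the Monge–Ampère equation
then reads `K |∇ψ|² = 0`. -/
lemma gradNormSq_eq_zero_of_interior_max (hψ : ContMDiff (𝓡∂ 2) 𝓘(ℝ, ℝ) 2 ψ)
    (hK : gaussCurvature g p ≠ 0) (hMA : MongeAmpereAt g ψ p)
    (hp : (𝓡∂ 2).IsInteriorPoint p) (hmax : ∀ q, gradNormSq g ψ q ≤ gradNormSq g ψ p) :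
    gradNormSq g ψ p = 0 := by
  by_contra hne
  have hyt : chartPoint p ∈ (extChartAt (𝓡∂ 2) p).target := mem_extChartAt_target p
  have hdet := (posDef_chartMetric g hyt).det_pos.ne'
  have hR : range (𝓡∂ 2) ∈ 𝓝 (chartPoint p) := mem_interior_iff_mem_nhds.mp hp
  have hlocal : IsLocalMax (coordGradNormSq (chartMetric g p) (chartFun ψ p)) (chartPoint p) := by
    have ht : (extChartAt (𝓡∂ 2) p).target ∈ 𝓝 (chartPoint p) := by
      rw [← nhdsWithin_eq_nhds.mpr hR]
      exact target_mem_nhdsWithin_range hyt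
    filter_upwards [ht] with x hx
    have h := coordGradNormSq_chart_eq g hψ ((extChartAt (𝓡∂ 2) p).map_target hx)
    rw [(extChartAt (𝓡∂ 2) p).right_inv hx] at h
    rw [h]
    exact hmax _
  have hcrit : ∀ i, partialDeriv i
      (coordGradNormSq (chartMetric g p) (chartFun ψ p)) (chartPoint p) = 0 := by
    intro i
    rw [partialDeriv, fderivWithin_of_mem_nhds hR, hlocal.fderiv_eq_zero]
    rfl
  have h0 := det_coordHessian_eq_zero (target_subset_range hyt) (chartMetric_symm g) hdet
    (differentiableWithinAt_chartMetric g hyt)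
    (differentiableWithinAt_partialDeriv_chartFun hψ hyt) hcrit hne
  -- the Monge–Ampère equation, with the determinant of the Hessian equal to zero
  have h1 : (0 : ℝ) = (chartMetric g p (chartPoint p)).det * gaussCurvature g p / 2
      * gradNormSq g ψ p := h0.symm.trans hMA
  have h2 : (chartMetric g p (chartPoint p)).det * gaussCurvature g p / 2 ≠ 0 :=
    div_ne_zero (mul_ne_zero hdet hK) two_ne_zero
  exact mul_ne_zero h2 hne h1.symm

/-! ### Functions with vanishing gradient -/

/-- On a connected surface, a function whose gradient vanishes is constant. -/
lemma exists_eq_const_of_gradNormSq_eq_zero [ConnectedSpace M]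
    (hψ : ContMDiff (𝓡∂ 2) 𝓘(ℝ, ℝ) 2 ψ) (h : ∀ p, gradNormSq g ψ p = 0) :
    ∃ c : ℝ, ∀ p : M, ψ p = c := by
  have hd : ∀ p, mfderiv (𝓡∂ 2) 𝓘(ℝ, ℝ) ψ p = 0 := by
    intro p
    obtain ⟨w, hw, hN⟩ := exists_gradient_of_mem_source g hψ (mem_extChartAt_source (I := 𝓡∂ 2) p)
    have hw0 : w = 0 := by
      by_contra hne
      have hpos := g.pos p w hne
      rw [← hN] at hpos
      exact hpos.ne' (h p)
    ext v
    rw [← hw v, hw0]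
    simp
    rfl
  have hloc : IsLocallyConstant ψ := by
    rw [IsLocallyConstant.iff_eventually_eq]
    intro p
    obtain ⟨ε, hε, hball⟩ := Metric.mem_nhdsWithin_iff.mp
      (target_mem_nhdsWithin_range (mem_extChartAt_target (I := 𝓡∂ 2) p))
    have hconv : Convex ℝ (Metric.ball (extChartAt (𝓡∂ 2) p p) ε ∩ range (𝓡∂ 2)) :=
      (convex_ball _ _).inter (𝓡∂ 2).convex_range
    have hderiv : ∀ y ∈ Metric.ball (extChartAt (𝓡∂ 2) p p) ε ∩ range (𝓡∂ 2),
        HasFDerivWithinAt (chartFun ψ p) (0 : Plane →L[ℝ] ℝ)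
          (Metric.ball (extChartAt (𝓡∂ 2) p p) ε ∩ range (𝓡∂ 2)) y := by
      intro y hy
      have hyt := hball hy
      have h1 := ((hψ.mdifferentiable (by simp)
        ((extChartAt (𝓡∂ 2) p).symm y)).hasMFDerivAt).comp_hasMFDerivWithinAt y
        (mdifferentiableWithinAt_extChartAt_symm hyt).hasMFDerivWithinAt
      rw [hd] at h1
      have h2 : HasFDerivWithinAt (chartFun ψ p) (0 : Plane →L[ℝ] ℝ) (range (𝓡∂ 2)) y :=
        h1.hasFDerivWithinAt
      exact h2.mono inter_subset_right
    have hpb : extChartAt (𝓡∂ 2) p p ∈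
        Metric.ball (extChartAt (𝓡∂ 2) p p) ε ∩ range (𝓡∂ 2) :=
      ⟨Metric.mem_ball_self hε, mem_range_self _⟩
    filter_upwards [extChartAt_source_mem_nhds (I := 𝓡∂ 2) p,
      (continuousAt_extChartAt (I := 𝓡∂ 2) p).eventually_mem (Metric.ball_mem_nhds _ hε)]
      with q hq hqb
    have hle := hconv.norm_image_sub_le_of_norm_hasFDerivWithin_le (C := 0) hderiv
      (fun _ _ => by simp) hpb ⟨hqb, mem_range_self _⟩
    simp only [chartFun] at hle
    rw [(extChartAt (𝓡∂ 2) p).left_inv hq, extChartAt_to_inv, zero_mul] at hle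
    exact sub_eq_zero.mp (norm_le_zero_iff.mp hle)
  obtain ⟨p₀⟩ := (inferInstance : Nonempty M)
  exact ⟨ψ p₀, fun p => hloc.apply_eq_of_preconnectedSpace p p₀⟩

end surface

end SurfaceGeometry

end

theorem mainTheorem5 {M : Type*} [TopologicalSpace M] [T2Space M] [CompactSpace M]
    [ConnectedSpace M] [ChartedSpace (EuclideanHalfSpace 2) M] [IsManifold (𝓡∂ 2) ∞ M]
    (g : SurfaceGeometry.Metric M)
    (hK : ∀ p : M, SurfaceGeometry.gaussCurvature g p ≠ 0)
    (hk : {p : M | p ∈ (𝓡∂ 2).boundary M ∧ SurfaceGeometry.geodesicCurvature g p = 0}.Finite)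
    (ψ : M → ℝ) (hψ : ContMDiff (𝓡∂ 2) 𝓘(ℝ, ℝ) 2 ψ)
    (hMA : ∀ p : M, SurfaceGeometry.MongeAmpereAt g ψ p)
    (hBC : ∀ p ∈ (𝓡∂ 2).boundary M, SurfaceGeometry.BoundaryConditionAt g ψ p) :
    ∃ c : ℝ, ∀ p : M, ψ p = c := by
  obtain ⟨p, -, hp⟩ := isCompact_univ.exists_isMaxOn Set.univ_nonempty
    (SurfaceGeometry.continuous_gradNormSq g hψ).continuousOn
  have hmax : ∀ q, SurfaceGeometry.gradNormSq g ψ q ≤ SurfaceGeometry.gradNormSq g ψ p :=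
    fun q => hp (Set.mem_univ q)
  have hzero : SurfaceGeometry.gradNormSq g ψ p = 0 := by
    rcases (𝓡∂ 2).isInteriorPoint_or_isBoundaryPoint p with h | h
    · exact SurfaceGeometry.gradNormSq_eq_zero_of_interior_max g hψ (hK p) (hMA p) h hmax
    · exact SurfaceGeometry.gradNormSq_eq_zero_of_mem_boundary g hψ hk hBC h
  exact SurfaceGeometry.exists_eq_const_of_gradNormSq_eq_zero g hψ fun q =>
    le_antisymm ((hmax q).trans_eq hzero) (SurfaceGeometry.gradNormSq_nonneg g hψ q)
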